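/- Let $p_0 = 1 + \frac{\log_6 2}{1 + \log_6 2}$ and let $0 < p < p_0$. Let $(X, \Sigma, \mu)$ be a nonatomic probability space and let $T : X \to X$ be an invertible (bijective and bimeasurable) $\mu$-preserving ergodic transformation. Then there are real-valued functions $F, G, H \in L^p(X, \Sigma, \mu)$ such that $$\limsup_{N \to \infty} \frac{1}{N} \sum_{n=1}^{N} F(T^n x)\, G(T^{2n} x)\, H(T^{3n} x) = \infty$$ for $\mu$-almost every $x \in X$. Here nonatomic means that every $A \in \Sigma$ with $\mu(A) > 0$ contains some $B \in \Sigma$ with $0 < \mu(B) < \mu(A)$. -/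

import Mathlib

open MeasureTheory Filter

/-- A measure is nonatomic if every measurable set of positive measure has a measurable subset
of strictly smaller, positive measure. (Mathlib's `NullSingletonClass` only says that points are null,
which is weaker on a general measurable space.) -/
def IsNonatomic {X : Type*} [MeasurableSpace X] (μ : Measure X) : Prop :=
  ∀ s : Set X, MeasurableSet s → 0 < μ s →
    ∃ t : Set X, t ⊆ s ∧ MeasurableSet t ∧ 0 < μ t ∧ μ t < μ s

/-- The trilinear Furstenberg average
`(1 / N) * ∑_{n = 1}^{N} F (T^n x) * G (T^{2n} x) * H (T^{3n} x)`. -/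
noncomputable def furstenbergAverage {X : Type*} (T : X → X) (F G H : X → ℝ) (N : ℕ) (x : X) :
    ℝ :=
  (1 / (N : ℝ)) *
    ∑ n ∈ Finset.Icc 1 N, F (T^[n] x) * G (T^[2 * n] x) * H (T^[3 * n] x)

/-! The functions are built from a periodic pattern of integers, spread over the space by a labelling.

*The pattern.* Every decimal digit `d` has a companion integer `e = digitShift d` such that
`d + e ∈ {2, 4, 6}`, `d + 2 e ∈ {2, 3, 4, 5}` and `d + 3 e ∈ {0, 2, 4, 6}`. Expanding `x` and `n`
in base ten, with the carries absorbed by the remaining quotient, this gives for `q = 10 ^ k` sets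
`U, V, W` of residues modulo `q`, of sizes at most `3 ^ k, 4 ^ k, 4 ^ k`, such that every `x` has
some `n ∈ [1, q]` with `x + n ∈ U`, `x + 2 n ∈ V`, `x + 3 n ∈ W`
(`exists_sparse_residues`). The product of the three densities is `(48 / 1000) ^ k`, and
`1000 / 48 > 20 > 10 ^ p`, since `p < 1.3`.

*The labelling.* Take a set `A` of tiny positive measure. The label of a point is minus its hitting
time of `A`, modulo `q`. It increases by one along the orbit except on `A`, and every value is taken
with probability at most `2 / q` (`exists_cyclic_label`, `measure_label_le`). Pulling the pattern back
gives sets of measure at most `2 (3 / 10) ^ k`, `2 (4 / 10) ^ k`, `2 (4 / 10) ^ k`, and outside an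
exceptional set of summable measure each `x` has some `n ≤ 10 ^ k` for which `T ^ n x`, `T ^ (2 n) x`,
`T ^ (3 n) x` lie in the respective sets (`exists_pattern_sets`).

*The functions.* Functions in `L ^ p` can be at least `3.3 ^ (k / p)`, respectively
`2.475 ^ (k / p)`, on these sets (`exists_memLp_ge_geometric`). At `N = n`, the single term `n` already
makes the average at least `λ ^ k` with `λ = (3.3 * 2.475 ^ 2) ^ (1 / p) / 10 > 1`, and by the
Borel–Cantelli lemma this happens for all large `k`, for almost every `x`. -/

/-! ### A sparse pattern in the integers -/

/-- The base-ten digit of `n` that goes with the digit `d` of `x`. The values `d + e`, `d + 2 * e`,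
`d + 3 * e` with `e = digitShift d` take only 3, 4 and 4 different values. -/
def digitShift (d : ℤ) : ℤ :=
  if d = 0 then 2 else if d = 1 then 1 else if d = 2 then 0 else if d = 3 then 1 else
  if d = 4 then 0 else if d = 5 then -1 else if d = 6 then -2 else if d = 7 then -1 else
  if d = 8 then -2 else -3

/-- The integers with `k` base-ten digits, all of them taken from `D`. -/
def digitSums (D : Finset ℤ) : ℕ → Finset ℤ
  | 0 => {0}
  | k + 1 => Finset.image₂ (fun d z => d + 10 * z) D (digitSums D k)

lemma card_digitSums_le (D : Finset ℤ) (k : ℕ) : (digitSums D k).card ≤ D.card ^ k := by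
  induction k with
  | zero => simp [digitSums]
  | succ k ih =>
    calc (digitSums D (k + 1)).card ≤ D.card * (digitSums D k).card := Finset.card_image₂_le _ _ _
      _ ≤ D.card * D.card ^ k := Nat.mul_le_mul_left _ ih
      _ = D.card ^ (k + 1) := by ring

lemma digitShift_spec (d : ℤ) (h0 : 0 ≤ d) (h9 : d < 10) :
    d + digitShift d ∈ ({2, 4, 6} : Finset ℤ) ∧ d + 2 * digitShift d ∈ ({2, 3, 4, 5} : Finset ℤ) ∧
      d + 3 * digitShift d ∈ ({0, 2, 4, 6} : Finset ℤ) := by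
  interval_cases d <;> decide

lemma exists_mem_digitSums (k : ℕ) (x : ℤ) :
    ∃ n : ℤ, (∃ u ∈ digitSums {2, 4, 6} k, (10 : ℤ) ^ k ∣ x + n - u) ∧
      (∃ v ∈ digitSums {2, 3, 4, 5} k, (10 : ℤ) ^ k ∣ x + 2 * n - v) ∧
      (∃ w ∈ digitSums {0, 2, 4, 6} k, (10 : ℤ) ^ k ∣ x + 3 * n - w) := by
  induction k generalizing x with
  | zero => exact ⟨0, by simp [digitSums]⟩
  | succ k ih =>
    obtain ⟨n, ⟨u, hu, hu'⟩, ⟨v, hv, hv'⟩, ⟨w, hw, hw'⟩⟩ := ih (x / 10)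
    obtain ⟨h1, h2, h3⟩ := digitShift_spec (x % 10) (by omega) (by omega)
    have hx : x = x % 10 + 10 * (x / 10) := (Int.emod_add_mul_ediv x 10).symm
    have step : ∀ m z : ℤ, (10 : ℤ) ^ k ∣ x / 10 + m * n - z →
        (10 : ℤ) ^ (k + 1) ∣ x + m * (digitShift (x % 10) + 10 * n) -
          (x % 10 + m * digitShift (x % 10) + 10 * z) := by
      intro m z h
      have he : x + m * (digitShift (x % 10) + 10 * n) -
          (x % 10 + m * digitShift (x % 10) + 10 * z) = (x / 10 + m * n - z) * 10 := by
        linear_combination hx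
      rw [he, pow_succ]
      exact mul_dvd_mul_right h 10
    refine ⟨digitShift (x % 10) + 10 * n, ⟨_, Finset.mem_image₂_of_mem h1 hu, ?_⟩,
      ⟨_, Finset.mem_image₂_of_mem h2 hv, step 2 v hv'⟩,
      ⟨_, Finset.mem_image₂_of_mem h3 hw, step 3 w hw'⟩⟩
    simpa using step 1 u (by simpa using hu')

lemma exists_sparse_residues (k : ℕ) :
    ∃ U V W : Finset (ZMod (10 ^ k)), U.card ≤ 3 ^ k ∧ V.card ≤ 4 ^ k ∧ W.card ≤ 4 ^ k ∧
      ∀ x : ZMod (10 ^ k), ∃ n : ℕ, 1 ≤ n ∧ n ≤ 10 ^ k ∧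
        x + n ∈ U ∧ x + (2 * n : ℕ) ∈ V ∧ x + (3 * n : ℕ) ∈ W := by
  classical
  refine ⟨(digitSums {2, 4, 6} k).image (fun z : ℤ => (z : ZMod (10 ^ k))),
    (digitSums {2, 3, 4, 5} k).image (fun z : ℤ => (z : ZMod (10 ^ k))),
    (digitSums {0, 2, 4, 6} k).image (fun z : ℤ => (z : ZMod (10 ^ k))),
    Finset.card_image_le.trans (card_digitSums_le _ _),
    Finset.card_image_le.trans (card_digitSums_le _ _),
    Finset.card_image_le.trans (card_digitSums_le _ _), fun x => ?_⟩
  obtain ⟨x, rfl⟩ := ZMod.intCast_surjective x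
  obtain ⟨n, ⟨u, hu, hu'⟩, ⟨v, hv, hv'⟩, ⟨w, hw, hw'⟩⟩ := exists_mem_digitSums k x
  have hq : (0 : ℤ) < 10 ^ k := by positivity
  -- The representative of `n` modulo `10 ^ k` in `[1, 10 ^ k]`.
  obtain ⟨m, hm⟩ := Int.eq_ofNat_of_zero_le (Int.emod_nonneg (n - 1) hq.ne')
  have hlt := Int.emod_lt_of_pos (n - 1) hq
  have hcast : ((m + 1 : ℕ) : ZMod (10 ^ k)) = (n : ZMod (10 ^ k)) := by
    have : (((m + 1 : ℕ) : ℤ) : ZMod (10 ^ k)) = (n : ZMod (10 ^ k)) := by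
      rw [ZMod.intCast_eq_intCast_iff_dvd_sub]
      refine ⟨(n - 1) / 10 ^ k, ?_⟩
      have := Int.emod_add_mul_ediv (n - 1) (10 ^ k)
      push_cast
      linarith
    simpa using this
  have hmem : ∀ (D : Finset ℤ) (j z : ℤ), z ∈ D → (10 : ℤ) ^ k ∣ x + j * n - z →
      (x : ZMod (10 ^ k)) + j * n ∈ D.image (fun z : ℤ => (z : ZMod (10 ^ k))) := by
    intro D j z hz h
    refine Finset.mem_image.2 ⟨z, hz, ?_⟩
    have : ((10 ^ k : ℕ) : ℤ) ∣ (x + j * n) - z := by exact_mod_cast h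
    rw [(ZMod.intCast_eq_intCast_iff_dvd_sub _ _ _).2 this]
    push_cast
    rfl
  refine ⟨m + 1, by omega, ?_, ?_, ?_, ?_⟩
  · have : (m : ℤ) < (10 ^ k : ℕ) := by push_cast; linarith
    omega
  · rw [hcast]
    simpa using hmem _ 1 u hu (by simpa using hu')
  · rw [Nat.cast_mul, hcast]
    simpa using hmem _ 2 v hv hv'
  · rw [Nat.cast_mul, hcast]
    simpa using hmem _ 3 w hw hw'

/-! ### Cyclic labellings of an ergodic system -/

section Label

variable {X : Type*} [MeasurableSpace X] {μ : Measure X}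

lemma IsNonatomic.exists_measure_lt [IsProbabilityMeasure μ] (hμ : IsNonatomic μ) {ε : ENNReal}
    (hε : 0 < ε) : ∃ s, MeasurableSet s ∧ 0 < μ s ∧ μ s < ε := by
  have key : ∀ n : ℕ, ∃ s, MeasurableSet s ∧ 0 < μ s ∧ μ s ≤ 2⁻¹ ^ n := by
    intro n
    induction n with
    | zero => exact ⟨Set.univ, MeasurableSet.univ, by simp, by simp⟩
    | succ n ih =>
      obtain ⟨s, hs, hs0, hsn⟩ := ih
      obtain ⟨t, hts, ht, ht0, hlt⟩ := hμ s hs hs0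
      have hsum : μ t + μ (s \ t) = μ s := by
        rw [measure_sdiff hts ht.nullMeasurableSet (measure_ne_top μ t), add_tsub_cancel_of_le hlt.le]
      have hhalf : ∀ a b : ENNReal, a + b = μ s → a ≤ b → a ≤ 2⁻¹ ^ (n + 1) := by
        intro a b hab h
        calc a = 2⁻¹ * (2 * a) := by
              rw [← mul_assoc, ENNReal.inv_mul_cancel two_ne_zero ENNReal.ofNat_ne_top, one_mul]
          _ ≤ 2⁻¹ * μ s := by rw [← hab, two_mul]; gcongr
          _ ≤ 2⁻¹ ^ (n + 1) := by rw [pow_succ']; gcongr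
      -- One of the two pieces `t` and `s \ t` has at most half the measure of `s`.
      rcases le_total (μ t) (μ (s \ t)) with h | h
      · exact ⟨t, ht, ht0, hhalf _ _ hsum h⟩
      · refine ⟨s \ t, hs.diff ht, ?_, hhalf _ _ (by rw [add_comm, hsum]) h⟩
        rw [pos_iff_ne_zero]
        intro h0
        rw [h0, add_zero] at hsum
        exact hlt.ne hsum
  obtain ⟨n, hn⟩ := ((ENNReal.tendsto_pow_atTop_nhds_zero_of_lt_one
    (ENNReal.inv_lt_one.2 ENNReal.one_lt_two)).eventually_lt_const hε).exists
  obtain ⟨s, hs, h0, h⟩ := key n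
  exact ⟨s, hs, h0, h.trans_lt hn⟩

lemma ae_exists_iterate_mem [IsProbabilityMeasure μ] {T : X → X} (hT : Ergodic T μ) {A : Set X}
    (hA : MeasurableSet A) (hA0 : 0 < μ A) : ∀ᵐ x ∂μ, ∃ n : ℕ, T^[n] x ∈ A := by
  have hm : MeasurableSet (⋃ n : ℕ, T^[n] ⁻¹' A) :=
    MeasurableSet.iUnion fun n => hT.measurable.iterate n hA
  have hsub : T ⁻¹' (⋃ n : ℕ, T^[n] ⁻¹' A) ⊆ ⋃ n : ℕ, T^[n] ⁻¹' A := by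
    intro x hx
    obtain ⟨n, hn⟩ := Set.mem_iUnion.1 hx
    exact Set.mem_iUnion.2 ⟨n + 1, hn⟩
  rcases hT.ae_empty_or_univ_of_preimage_ae_le hm.nullMeasurableSet
    (LE.le.eventuallyLE hsub) with h | h
  · have h0 : μ A = 0 := by
      refine measure_mono_null (t := ⋃ n : ℕ, T^[n] ⁻¹' A) ?_ (ae_eq_empty.1 h)
      exact Set.subset_iUnion (fun n : ℕ => T^[n] ⁻¹' A) 0
    exact absurd h0 hA0.ne'
  · filter_upwards [eventuallyEq_univ.1 h] with x hx
    simpa using hx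

/-- A labelling of the space by residues modulo `q` that increases by one along orbits, up to a set of
small measure. It stands in for a Rokhlin tower of height `q`. -/
lemma exists_cyclic_label [IsProbabilityMeasure μ] (hμ : IsNonatomic μ) {T : X → X}
    (hT : Ergodic T μ) (q : ℕ) {δ : ENNReal} (hδ : 0 < δ) :
    ∃ c : X → ZMod q, (∀ S : Set (ZMod q), MeasurableSet (c ⁻¹' S)) ∧
      μ {x | c (T x) ≠ c x + 1} ≤ δ := by
  classical
  obtain ⟨A, hA, hA0, hAδ⟩ := hμ.exists_measure_lt hδ
  -- The second alternative only makes the hitting time defined on the null set of points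
  -- whose orbit misses `A`.
  let P : X → ℕ → Prop := fun x j => T^[j] x ∈ A ∨ ∀ i : ℕ, T^[i] x ∉ A
  have hP : ∀ x, ∃ j, P x j := by
    intro x
    by_cases h : ∃ j, T^[j] x ∈ A
    · exact h.imp fun j hj => Or.inl hj
    · exact ⟨0, Or.inr (not_exists.1 h)⟩
  have hmT : ∀ j : ℕ, MeasurableSet {x | T^[j] x ∈ A} := fun j => hT.measurable.iterate j hA
  have hPm : ∀ j, MeasurableSet {x | P x j} := by
    intro j
    have hnever : MeasurableSet {x | ∀ i : ℕ, T^[i] x ∉ A} := by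
      rw [Set.ofPred_forall]
      exact MeasurableSet.iInter fun i => (hmT i).compl
    exact (hmT j).union hnever
  have hfind : Measurable fun x => Nat.find (hP x) := measurable_find hP hPm
  refine ⟨fun x => -((Nat.find (hP x) : ℕ) : ZMod q), fun S => ?_, ?_⟩
  · exact hfind (MeasurableSet.of_discrete (s := {n : ℕ | -(n : ZMod q) ∈ S}))
  · refine le_trans (measure_mono_ae ?_) hAδ.le
    filter_upwards [ae_exists_iterate_mem hT hA hA0] with x hx hne
    by_contra hxA
    refine hne ?_
    obtain ⟨j, hj⟩ := hx
    obtain ⟨i, rfl⟩ : ∃ i, j = i + 1 := Nat.exists_eq_succ_of_ne_zero (by rintro rfl; exact hxA hj)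
    have hxP : ∀ m, P x m ↔ T^[m] x ∈ A := fun m =>
      ⟨fun h => h.resolve_right fun h' => h' _ hj, Or.inl⟩
    have hTP : ∀ m, P (T x) m ↔ T^[m] (T x) ∈ A := fun m =>
      ⟨fun h => h.resolve_right fun h' => h' i hj, Or.inl⟩
    have hsucc : Nat.find (hP x) = Nat.find (hP (T x)) + 1 := by
      rw [Nat.find_eq_iff]
      refine ⟨(hxP _).2 ((hTP _).1 (Nat.find_spec (hP (T x)))), fun m hm hPm' => ?_⟩
      rcases m with _ | m
      · exact hxA ((hxP 0).1 hPm')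
      · exact Nat.find_min (hP (T x)) (by omega) ((hTP m).2 ((hxP (m + 1)).1 hPm'))
    change -((Nat.find (hP (T x)) : ℕ) : ZMod q) = -((Nat.find (hP x) : ℕ) : ZMod q) + 1
    rw [hsucc]
    push_cast
    ring

/-- A labelling that increases by one along orbits is nearly equidistributed, because consecutive
fibres have nearly the same measure. -/
lemma measure_label_le [IsProbabilityMeasure μ] {T : X → X} (hT : MeasurePreserving T μ μ) {q : ℕ}
    [NeZero q] {c : X → ZMod q} (hc : ∀ S : Set (ZMod q), MeasurableSet (c ⁻¹' S))
    {δ : ENNReal} (hδ : μ {x | c (T x) ≠ c x + 1} ≤ δ) (hδq : (q : ENNReal) * (q * δ) ≤ 1)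
    (S : Finset (ZMod q)) : μ (c ⁻¹' S) ≤ S.card * (2 / q) := by
  have hstep : ∀ r, μ (c ⁻¹' {r}) ≤ μ (c ⁻¹' {r + 1}) + δ := by
    intro r
    rw [← hT.measure_preimage (hc {r + 1}).nullMeasurableSet]
    refine le_trans (measure_mono ?_) ((measure_union_le _ _).trans (add_le_add_right hδ _))
    intro x hx
    by_cases h : c (T x) = c x + 1
    · left
      simp only [Set.mem_preimage, Set.mem_singleton_iff] at hx ⊢
      rw [h, hx]
    · exact Or.inr h
  have hiter : ∀ r, ∀ j : ℕ, μ (c ⁻¹' {r}) ≤ μ (c ⁻¹' {r + j}) + j * δ := by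
    intro r j
    induction j with
    | zero => simp
    | succ j ih =>
      calc μ (c ⁻¹' {r}) ≤ μ (c ⁻¹' {r + j}) + j * δ := ih
        _ ≤ μ (c ⁻¹' {r + j + 1}) + δ + j * δ := by gcongr; exact hstep _
        _ = μ (c ⁻¹' {r + (j + 1 : ℕ)}) + (j + 1 : ℕ) * δ := by push_cast; rw [add_assoc r]; ring
  have hall : ∀ r s, μ (c ⁻¹' {r}) ≤ μ (c ⁻¹' {s}) + q * δ := by
    intro r s
    have h := hiter r (s - r).val
    rw [ZMod.natCast_zmod_val, add_sub_cancel] at h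
    refine h.trans ?_
    gcongr
    exact (ZMod.val_lt _).le
  have hsum : ∑ s : ZMod q, μ (c ⁻¹' {s}) = 1 := by
    rw [← measure_biUnion_finset (fun a _ b _ hab => Set.disjoint_left.2 fun x hx hx' =>
      hab (hx.symm.trans hx')) (fun s _ => hc {s})]
    have : (⋃ s ∈ (Finset.univ : Finset (ZMod q)), c ⁻¹' {s}) = Set.univ := by ext x; simp
    rw [this, measure_univ]
  have hq0 : (q : ENNReal) ≠ 0 := by exact_mod_cast NeZero.ne q
  have hone : ∀ r, μ (c ⁻¹' {r}) ≤ 2 / q := by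
    intro r
    rw [ENNReal.le_div_iff_mul_le (Or.inl hq0) (Or.inl (ENNReal.natCast_ne_top q))]
    calc μ (c ⁻¹' {r}) * q = ∑ _s : ZMod q, μ (c ⁻¹' {r}) := by
          rw [Finset.sum_const, Finset.card_univ, ZMod.card, nsmul_eq_mul, mul_comm]
      _ ≤ ∑ s : ZMod q, (μ (c ⁻¹' {s}) + q * δ) := Finset.sum_le_sum fun s _ => hall r s
      _ = 1 + q * (q * δ) := by
          rw [Finset.sum_add_distrib, hsum, Finset.sum_const, Finset.card_univ, ZMod.card,
            nsmul_eq_mul]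
      _ ≤ 1 + 1 := by gcongr
      _ = 2 := one_add_one_eq_two
  calc μ (c ⁻¹' S) = μ (⋃ s ∈ S, c ⁻¹' {s}) := by congr 1; ext x; simp
    _ ≤ ∑ s ∈ S, μ (c ⁻¹' {s}) := measure_biUnion_finset_le _ _
    _ ≤ ∑ _s ∈ S, (2 / q : ENNReal) := Finset.sum_le_sum fun s _ => hone s
    _ = S.card * (2 / q) := by rw [Finset.sum_const, nsmul_eq_mul]

/-! ### The pattern in the ergodic system -/

/-- The sets on which the three functions will be large, with the exceptional set `B`. -/
lemma exists_pattern_sets [IsProbabilityMeasure μ] (hμ : IsNonatomic μ) {T : X → X}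
    (hT : Ergodic T μ) (k : ℕ) :
    ∃ U V W B : Set X, MeasurableSet U ∧ MeasurableSet V ∧ MeasurableSet W ∧
      μ U ≤ ENNReal.ofReal (2 * (3 / 10) ^ k) ∧ μ V ≤ ENNReal.ofReal (2 * (4 / 10) ^ k) ∧
      μ W ≤ ENNReal.ofReal (2 * (4 / 10) ^ k) ∧ μ B ≤ ENNReal.ofReal (3 * (1 / 10) ^ k) ∧
      ∀ x ∉ B, ∃ n : ℕ, 1 ≤ n ∧ n ≤ 10 ^ k ∧ T^[n] x ∈ U ∧ T^[2 * n] x ∈ V ∧ T^[3 * n] x ∈ W := by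
  obtain ⟨U, V, W, hU, hV, hW, hpat⟩ := exists_sparse_residues k
  have : NeZero (10 ^ k) := ⟨by positivity⟩
  have hδ : 0 < ENNReal.ofReal ((1 / 10) ^ k * (1 / 10) ^ k) := by
    rw [ENNReal.ofReal_pos]; positivity
  obtain ⟨c, hc, hcT⟩ := exists_cyclic_label hμ hT (10 ^ k) hδ
  have hqr : ((10 ^ k : ℕ) : ENNReal) = ENNReal.ofReal (10 ^ k) := by
    rw [← ENNReal.ofReal_natCast]; norm_num
  have hcancel : (10 : ℝ) ^ k * (1 / 10) ^ k = 1 := by rw [← mul_pow]; norm_num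
  have hδq : ((10 ^ k : ℕ) : ENNReal) * ((10 ^ k : ℕ) *
      ENNReal.ofReal ((1 / 10) ^ k * (1 / 10) ^ k)) ≤ 1 := by
    rw [hqr, ← ENNReal.ofReal_mul (by positivity), ← ENNReal.ofReal_mul (by positivity)]
    rw [← mul_assoc ((10 : ℝ) ^ k) ((1 / 10) ^ k), hcancel, one_mul, hcancel]
    simp
  have hmeas : ∀ (S : Finset (ZMod (10 ^ k))) (m : ℕ), S.card ≤ m ^ k →
      μ (c ⁻¹' S) ≤ ENNReal.ofReal (2 * ((m : ℝ) / 10) ^ k) := by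
    intro S m hS
    refine (measure_label_le hT.toMeasurePreserving hc hcT hδq S).trans ?_
    calc (S.card : ENNReal) * (2 / (10 ^ k : ℕ)) ≤ (m ^ k : ℕ) * (2 / (10 ^ k : ℕ)) := by gcongr
      _ = ENNReal.ofReal (2 * ((m : ℝ) / 10) ^ k) := by
        rw [hqr, ← ENNReal.ofReal_natCast (m ^ k), ← ENNReal.ofReal_ofNat 2,
          ← ENNReal.ofReal_div_of_pos (by positivity), ← ENNReal.ofReal_mul (by positivity)]
        congr 1
        push_cast
        rw [div_pow]
        ring
  have hE : MeasurableSet {x | c (T x) ≠ c x + 1} := by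
    have : {x | c (T x) ≠ c x + 1} = ⋃ r, (c ⁻¹' {r} \ T ⁻¹' (c ⁻¹' {r + 1})) := by
      ext x; simp
    rw [this]
    exact MeasurableSet.iUnion fun r => (hc {r}).diff (hT.measurable (hc {r + 1}))
  refine ⟨c ⁻¹' U, c ⁻¹' V, c ⁻¹' W,
    ⋃ j ∈ Finset.range (3 * 10 ^ k), T^[j] ⁻¹' {x | c (T x) ≠ c x + 1},
    hc _, hc _, hc _, by simpa using hmeas U 3 hU, by simpa using hmeas V 4 hV,
    by simpa using hmeas W 4 hW, ?_, fun x hx => ?_⟩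
  · calc _ ≤ ∑ j ∈ Finset.range (3 * 10 ^ k), μ (T^[j] ⁻¹' {x | c (T x) ≠ c x + 1}) :=
          measure_biUnion_finset_le _ _
      _ ≤ ∑ _j ∈ Finset.range (3 * 10 ^ k), ENNReal.ofReal ((1 / 10) ^ k * (1 / 10) ^ k) := by
          refine Finset.sum_le_sum fun j _ => ?_
          rw [(hT.toMeasurePreserving.iterate j).measure_preimage hE.nullMeasurableSet]
          exact hcT
      _ = ENNReal.ofReal (3 * (1 / 10) ^ k) := by
          rw [Finset.sum_const, Finset.card_range, nsmul_eq_mul,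
            ← ENNReal.ofReal_natCast (3 * 10 ^ k), ← ENNReal.ofReal_mul (by positivity)]
          congr 1
          push_cast
          linear_combination 3 * (1 / 10 : ℝ) ^ k * hcancel
  · have hlabel : ∀ j ≤ 3 * 10 ^ k, c (T^[j] x) = c x + j := by
      intro j
      induction j with
      | zero => simp
      | succ j ih =>
        intro hj
        have hgood : c (T (T^[j] x)) = c (T^[j] x) + 1 := by
          by_contra h
          exact hx (Set.mem_biUnion (Finset.mem_coe.2 (Finset.mem_range.2 (by omega))) h)
        rw [Function.iterate_succ_apply', hgood, ih (by omega)]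
        push_cast
        ring
    obtain ⟨n, hn1, hn, hu, hv, hw⟩ := hpat (c x)
    refine ⟨n, hn1, hn, ?_, ?_, ?_⟩
    · rw [Set.mem_preimage, hlabel n (by omega)]; exact hu
    · rw [Set.mem_preimage, hlabel (2 * n) (by omega)]; exact hv
    · rw [Set.mem_preimage, hlabel (3 * n) (by omega)]; exact hw

/-! ### Functions in `L ^ p` that are large on prescribed sets -/

lemma exists_memLp_ge_geometric {p : ℝ} (hp : 0 < p) {r s : ℝ} (hr : 0 ≤ r) (hs : 0 ≤ s)
    (hrs : r * s < 1) {U : ℕ → Set X} (hU : ∀ k, MeasurableSet (U k))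
    (hμU : ∀ k, μ (U k) ≤ ENNReal.ofReal (2 * s ^ k)) :
    ∃ F : X → ℝ, MemLp F (ENNReal.ofReal p) μ ∧ (∀ x, 0 ≤ F x) ∧
      ∀ᵐ x ∂μ, ∀ k, x ∈ U k → (r ^ (1 / p)) ^ k ≤ F x := by
  let g : X → ENNReal := fun x => ∑' k, (U k).indicator (fun _ => ENNReal.ofReal (r ^ k)) x
  have hgk : ∀ k, Measurable ((U k).indicator fun _ => ENNReal.ofReal (r ^ k)) := fun k =>
    measurable_const.indicator (hU k)
  have hg : Measurable g := Measurable.tsum hgk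
  have hgint : ∫⁻ x, g x ∂μ < ⊤ := by
    calc ∫⁻ x, g x ∂μ = ∑' k, ENNReal.ofReal (r ^ k) * μ (U k) := by
          rw [lintegral_tsum fun k => (hgk k).aemeasurable]
          simp_rw [lintegral_indicator_const (hU _)]
      _ ≤ ∑' k, ENNReal.ofReal (2 * (r * s) ^ k) := by
          refine ENNReal.tsum_le_tsum fun k => ?_
          calc ENNReal.ofReal (r ^ k) * μ (U k)
              ≤ ENNReal.ofReal (r ^ k) * ENNReal.ofReal (2 * s ^ k) := by gcongr; exact hμU k
            _ = ENNReal.ofReal (2 * (r * s) ^ k) := by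
                rw [← ENNReal.ofReal_mul (by positivity), mul_pow]
                congr 1
                ring
      _ < ⊤ := ((summable_geometric_of_lt_one (mul_nonneg hr hs) hrs).mul_left 2).tsum_ofReal_lt_top
  have hfin : ∀ᵐ x ∂μ, g x < ⊤ := ae_lt_top hg hgint.ne
  refine ⟨fun x => (g x).toReal ^ (1 / p), ⟨?_, ?_⟩, fun x => by positivity, ?_⟩
  · exact (hg.ennreal_toReal.pow_const _).aestronglyMeasurable
  · rw [eLpNorm_lt_top_iff_lintegral_rpow_enorm_lt_top (by simpa using hp) ENNReal.ofReal_ne_top,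
      ENNReal.toReal_ofReal hp.le]
    refine lt_of_le_of_lt (lintegral_mono fun x => ?_) hgint
    have h0 : 0 ≤ (g x).toReal ^ (1 / p) := by positivity
    rw [Real.enorm_eq_ofReal h0, ENNReal.ofReal_rpow_of_nonneg h0 hp.le,
      ← Real.rpow_mul ENNReal.toReal_nonneg, one_div_mul_cancel hp.ne', Real.rpow_one]
    exact ENNReal.ofReal_toReal_le
  · filter_upwards [hfin] with x hx k hk
    have hle : ENNReal.ofReal (r ^ k) ≤ g x := by
      refine le_trans (le_of_eq ?_) (ENNReal.le_tsum k)
      rw [Set.indicator_of_mem hk]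
    have hle' : r ^ k ≤ (g x).toReal := (ENNReal.ofReal_le_iff_le_toReal hx.ne).1 hle
    calc (r ^ (1 / p)) ^ k = (r ^ k) ^ (1 / p) := by
          rw [← Real.rpow_natCast, ← Real.rpow_mul hr, mul_comm, Real.rpow_mul hr, Real.rpow_natCast]
      _ ≤ (g x).toReal ^ (1 / p) := Real.rpow_le_rpow (by positivity) hle' (by positivity)

end Label

/-! ### Divergence of the averages -/

/-- A sequence of reals is unbounded only through large indices, so lower bounds `l ^ k` at
unspecified indices force an infinite upper limit. -/
lemma limsup_eq_top_of_geometric {u : ℕ → ℝ} {l : ℝ} (hl : 1 < l)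
    (h : ∀ᶠ k : ℕ in atTop, ∃ n, l ^ k ≤ u n) :
    limsup (fun n => (u n : EReal)) atTop = ⊤ := by
  have hfreq : ∀ M : ℝ, ∃ᶠ n in atTop, M ≤ u n := by
    intro M hM
    obtain ⟨N, hN⟩ := eventually_atTop.1 hM
    obtain ⟨C, hC⟩ := ((Finset.range N).image u).bddAbove
    obtain ⟨k, ⟨n, hn⟩, hk⟩ :=
      (h.and ((tendsto_pow_atTop_atTop_of_one_lt hl).eventually_gt_atTop (max C M))).exists
    rcases lt_or_ge n N with hnN | hnN
    · have : u n ≤ C := hC (by simpa using ⟨n, hnN, rfl⟩)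
      exact absurd (hk.trans_le hn) (not_lt.2 (this.trans (le_max_left _ _)))
    · exact hN n hnN ((le_max_right C M).trans (hk.le.trans hn))
  rw [EReal.eq_top_iff_forall_lt]
  intro y
  refine lt_of_lt_of_le (EReal.coe_lt_coe_iff.2 (lt_add_one y)) (le_limsup_of_frequently_le' ?_)
  exact (hfreq (y + 1)).mono fun n hn => EReal.coe_le_coe_iff.2 hn

lemma exponent_lt {p : ℝ} (hp₀ : p < 1 + Real.logb 6 2 / (1 + Real.logb 6 2)) : p < 13 / 10 := by
  have h0 : 0 < Real.logb 6 2 := Real.logb_pos (by norm_num) (by norm_num)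
  have h : 7 * Real.logb 6 2 ≤ 3 := by
    have h1 : Real.logb 6 ((2 : ℝ) ^ 7) ≤ Real.logb 6 ((6 : ℝ) ^ 3) :=
      Real.logb_le_logb_of_le (by norm_num) (by norm_num) (by norm_num)
    rw [Real.logb_pow, Real.logb_pow, Real.logb_self_eq_one (by norm_num)] at h1
    norm_num at h1
    linarith
  have h2 : Real.logb 6 2 / (1 + Real.logb 6 2) ≤ 3 / 10 := by
    rw [div_le_iff₀ (by linarith)]
    linarith
  linarith

/-- This comes down to `10 ^ p < 20 < 3.3 * 2.475 ^ 2`, where `10 ^ 1.3 < 20` since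
`10 ^ 13 < 20 ^ 10`. -/
lemma one_lt_growth {p : ℝ} (hp : 0 < p) (hp' : p < 13 / 10) :
    1 < (33 / 10 : ℝ) ^ (1 / p) * (2475 / 1000) ^ (1 / p) * (2475 / 1000) ^ (1 / p) / 10 := by
  rw [one_lt_div (by norm_num), ← Real.mul_rpow (by norm_num) (by norm_num),
    ← Real.mul_rpow (by norm_num) (by norm_num), one_div,
    Real.lt_rpow_inv_iff_of_pos (by norm_num) (by norm_num) hp]
  calc (10 : ℝ) ^ p < 10 ^ (13 / 10 : ℝ) := Real.rpow_lt_rpow_of_exponent_lt (by norm_num) hp'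
    _ = (10 ^ 13) ^ ((10 : ℝ)⁻¹) := by
      rw [← Real.rpow_natCast 10 13, ← Real.rpow_mul (by norm_num)]
      norm_num
    _ ≤ (20 ^ 10) ^ ((10 : ℝ)⁻¹) := Real.rpow_le_rpow (by norm_num) (by norm_num) (by norm_num)
    _ = 20 := by
      rw [← Real.rpow_natCast 20 10, ← Real.rpow_mul (by norm_num)]
      norm_num
    _ ≤ 33 / 10 * (2475 / 1000) * (2475 / 1000) := by norm_num

theorem theorem1 (p : ℝ) (hp : 0 < p)
    (hp₀ : p < 1 + Real.logb 6 2 / (1 + Real.logb 6 2))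
    {X : Type*} [MeasurableSpace X] (μ : Measure X) [IsProbabilityMeasure μ]
    (hμ : IsNonatomic μ) (T : X ≃ᵐ X) (hT : Ergodic T μ) :
    ∃ F G H : X → ℝ,
      MemLp F (ENNReal.ofReal p) μ ∧ MemLp G (ENNReal.ofReal p) μ ∧
      MemLp H (ENNReal.ofReal p) μ ∧
      ∀ᵐ x ∂μ, limsup (fun N : ℕ => (furstenbergAverage T F G H N x : EReal)) atTop = ⊤ := by
  choose U V W B hU hV hW hμU hμV hμW hμB hpat using exists_pattern_sets hμ hT
  -- The rates 3.3 and 2.475 are 0.99 times the reciprocals of the densities 0.3 and 0.4.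
  obtain ⟨F, hF, hF0, hFU⟩ := exists_memLp_ge_geometric (μ := μ) hp (r := 33 / 10) (s := 3 / 10)
    (by norm_num) (by norm_num) (by norm_num) hU hμU
  obtain ⟨G, hG, hG0, hGV⟩ := exists_memLp_ge_geometric (μ := μ) hp (r := 2475 / 1000) (s := 4 / 10)
    (by norm_num) (by norm_num) (by norm_num) hV hμV
  obtain ⟨H, hH, hH0, hHW⟩ := exists_memLp_ge_geometric (μ := μ) hp (r := 2475 / 1000) (s := 4 / 10)
    (by norm_num) (by norm_num) (by norm_num) hW hμW
  refine ⟨F, G, H, hF, hG, hH, ?_⟩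
  have horbit : ∀ {P : X → Prop}, (∀ᵐ x ∂μ, P x) → ∀ᵐ x ∂μ, ∀ j : ℕ, P (T^[j] x) := fun h =>
    ae_all_iff.2 fun j => (hT.toMeasurePreserving.iterate j).quasiMeasurePreserving.ae h
  have hBsum : ∑' k, μ (B k) ≠ ⊤ := by
    refine ne_top_of_le_ne_top ?_ (ENNReal.tsum_le_tsum hμB)
    exact ((summable_geometric_of_lt_one (r := (1 / 10 : ℝ)) (by norm_num)
      (by norm_num)).mul_left 3).tsum_ofReal_ne_top
  filter_upwards [horbit hFU, horbit hGV, horbit hHW, ae_eventually_notMem hBsum]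
    with x hx1 hx2 hx3 hxB
  refine limsup_eq_top_of_geometric (one_lt_growth hp (exponent_lt hp₀)) ?_
  filter_upwards [hxB] with k hk
  obtain ⟨n, hn1, hn, hu, hv, hw⟩ := hpat k x hk
  refine ⟨n, ?_⟩
  set a : ℝ := (33 / 10 : ℝ) ^ (1 / p)
  set b : ℝ := (2475 / 1000 : ℝ) ^ (1 / p)
  have ha : 0 ≤ a := by positivity
  have hb : 0 ≤ b := by positivity
  have hn0 : (0 : ℝ) < n := by exact_mod_cast hn1
  have hn' : (n : ℝ) ≤ 10 ^ k := by exact_mod_cast hn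
  have hterm : a ^ k * b ^ k * b ^ k ≤ F (T^[n] x) * G (T^[2 * n] x) * H (T^[3 * n] x) := by
    have h1 := hx1 n k hu
    have h2 := hx2 (2 * n) k hv
    have h3 := hx3 (3 * n) k hw
    have := hF0 (T^[n] x)
    have := hG0 (T^[2 * n] x)
    gcongr
  have hsum : F (T^[n] x) * G (T^[2 * n] x) * H (T^[3 * n] x) ≤
      ∑ m ∈ Finset.Icc 1 n, F (T^[m] x) * G (T^[2 * m] x) * H (T^[3 * m] x) :=
    Finset.single_le_sum (f := fun m => F (T^[m] x) * G (T^[2 * m] x) * H (T^[3 * m] x))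
      (fun m _ => mul_nonneg (mul_nonneg (hF0 _) (hG0 _)) (hH0 _)) (Finset.mem_Icc.2 ⟨hn1, le_rfl⟩)
  calc (a * b * b / 10) ^ k = 1 / 10 ^ k * (a ^ k * b ^ k * b ^ k) := by
        rw [div_pow, mul_pow, mul_pow]; ring
    _ ≤ 1 / n * (a ^ k * b ^ k * b ^ k) := by gcongr
    _ ≤ 1 / n * ∑ m ∈ Finset.Icc 1 n, F (T^[m] x) * G (T^[2 * m] x) * H (T^[3 * m] x) := by
        gcongr
        exact hterm.trans hsum
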